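/- Let $G$ be a finite simple graph. In positive semidefinite (PSD) zero forcing, an initial set of vertices of $G$ is colored blue and all other vertices are white. In each round, let $S$ be the current set of blue vertices and let $W_1,\dots,W_r$ be the vertex sets of the connected components of $G-S$; a blue vertex $v$ colors a white neighbor $w$ of $v$ blue if, for some $i$, $w$ is the only white neighbor of $v$ in the subgraph of $G$ induced by $W_i\cup S$. All such colorings in a round are performed simultaneously. Let $\operatorname{pt}_+(G,k)$ be the minimum number of rounds after which all of $G$ is blue, over all initial blue sets of size $k$ (with value $\infty$ if no such set colors all of $G$ blue), and let $\operatorname{th}_+(G)=\min_k\{k+\operatorname{pt}_+(G,k)\}$ be the PSD throttling number of $G$. Then there exists $N$ such that for every integer $n\ge N$ there is a tree $T$ of order $n$ with $$\operatorname{th}_+(T) > 1.4502\sqrt{n}.$$ -/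

import Mathlib

namespace PSDForcing

variable {V : Type*}

/-- With `S` the set of blue vertices, the blue vertex `v` can colour the white vertex `w` blue:
for some connected component `C` of `G - S`, with vertex set `W`, the vertex `w` is the only white
neighbour of `v` in the subgraph of `G` induced by `W ∪ S`, that is, the only neighbour of `v`
in `W`. -/
def Forces (G : SimpleGraph V) (S : Set V) (v w : V) : Prop :=
  v ∈ S ∧ ∃ C : (G.induce Sᶜ).ConnectedComponent,
    G.neighborSet v ∩ (Subtype.val '' C.supp) = {w}

/-- One round of PSD zero forcing: all possible forces are performed simultaneously. -/
def step (G : SimpleGraph V) (S : Set V) : Set V :=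
  S ∪ {w | ∃ v, Forces G S v w}

/-- The set of blue vertices after `t` rounds, starting from the blue set `S`. -/
def blueAfter (G : SimpleGraph V) (S : Set V) (t : ℕ) : Set V :=
  (step G)^[t] S

/-- The number of rounds needed to colour all of `G` blue, starting from the blue set `S`
(`⊤` if this never happens). -/
noncomputable def propTime (G : SimpleGraph V) (S : Set V) : ℕ∞ :=
  ⨅ (t : ℕ) (_ : blueAfter G S t = Set.univ), (t : ℕ∞)

/-- `pt₊(G, k)`: the minimum number of rounds needed to colour all of `G` blue, over all initial
blue sets of size `k` (`⊤` if there is no such set that colours all of `G` blue). -/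
noncomputable def minPropTime (G : SimpleGraph V) (k : ℕ) : ℕ∞ :=
  ⨅ (S : Finset V) (_ : S.card = k), propTime G (S : Set V)

/-- The PSD throttling number `th₊(G) = min_k (k + pt₊(G, k))`. The minimum is finite for every
finite graph, see `iInf_ne_top`. -/
noncomputable def throttlingNumber (G : SimpleGraph V) : ℕ :=
  (⨅ k : ℕ, ((k : ℕ∞) + minPropTime G k)).toNat

theorem iInf_ne_top [Fintype V] (G : SimpleGraph V) :
    (⨅ k : ℕ, ((k : ℕ∞) + minPropTime G k)) ≠ ⊤ := by
  have h0 : minPropTime G (Fintype.card V) ≤ 0 := by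
    refine (iInf₂_le (Finset.univ : Finset V) Finset.card_univ).trans ?_
    refine (iInf₂_le 0 ?_).trans (by simp)
    simp [blueAfter]
  refine ne_top_of_le_ne_top (b := ((Fintype.card V : ℕ) : ℕ∞)) (ENat.natCast_ne_top _) ?_
  refine (iInf_le _ (Fintype.card V)).trans ?_
  simp [nonpos_iff_eq_zero.mp h0]

end PSDForcing

/-! Take a spider with legs of lengths `m + 1, …, 3 * m`, about `4 * m ^ 2` vertices. Blue spreads
by at most one edge per round, so after `t` rounds a vertex deeper than `t` owes its colour to an
initial blue vertex of its own leg (`exists_mem_of_mem_blueAfter`). Hence each leg longer than `t`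
needs one initial vertex, and each longer than `3 * t + 1` needs two. Counting gives throttling
number at least `3 * m`, and the ratio to the root of the order tends to `3 / 2`. -/

/-- The graph joining every vertex to its parent is a tree, if the parent of every vertex other
than the root has smaller rank. -/
theorem isTree_fromRel_parent {V : Type*} [Finite V] (root : V) (p : V → V) (d : V → ℕ)
    (hroot : p root = root) (hd : ∀ v, v ≠ root → d (p v) < d v) :
    (SimpleGraph.fromRel fun u v => p u = v).IsTree := by
  classical
  set G := SimpleGraph.fromRel fun u v => p u = v with hG
  have hadj : ∀ v, v ≠ root → G.Adj v (p v) := by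
    intro v hv
    rw [hG, SimpleGraph.fromRel_adj]
    refine ⟨fun h => ?_, Or.inl rfl⟩
    have := hd v hv
    rw [← h] at this
    exact lt_irrefl _ this
  have hreach : ∀ k v, d v = k → G.Reachable v root := by
    intro k
    induction k using Nat.strong_induction_on with
    | _ k ih =>
      intro v hk
      by_cases hv : v = root
      · rw [hv]
      · exact (hadj v hv).reachable.trans (ih _ (hk ▸ hd v hv) _ rfl)
  have hconn : G.Connected :=
    { preconnected := fun u v => (hreach _ u rfl).trans (hreach _ v rfl).symm
      nonempty := ⟨root⟩ }
  refine SimpleGraph.isTree_iff_connected_and_card.2 ⟨hconn, le_antisymm ?_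
    hconn.card_vert_le_card_edgeSet_add_one⟩
  -- Every edge joins a non-root vertex to its parent, so edges are fewer than vertices.
  have hsurj : Function.Surjective
      (fun v : {v : V // v ≠ root} => (⟨s(v.1, p v.1), hadj v.1 v.2⟩ : G.edgeSet)) := by
    rintro ⟨e, he⟩
    induction e using Sym2.ind with
    | _ a b =>
      have hab : a ≠ b ∧ (p a = b ∨ p b = a) := by
        simpa [hG, SimpleGraph.fromRel_adj] using he
      obtain ⟨hne, h | h⟩ := hab
      · refine ⟨⟨a, fun ha => hne ?_⟩, Subtype.ext ?_⟩
        · rw [← h, ha, hroot]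
        · simp [h]
      · refine ⟨⟨b, fun hb => hne ?_⟩, Subtype.ext ?_⟩
        · rw [← h, hb, hroot]
        · simp [h, Sym2.eq_swap]
  have h1 : Nat.card G.edgeSet ≤ _ := Nat.card_le_card_of_surjective _ hsurj
  have h2 : Nat.card {v : V // v ≠ root} < Nat.card V :=
    Finite.card_subtype_lt (x := root) (by simp)
  omega

namespace PSDForcing

/-- If adjacent vertices of positive depth lie on the same leg, at depths differing by at most one,
then a vertex deeper than `t` that is blue after `t` rounds is within distance `t` of an initially
blue vertex of its own leg. -/
theorem exists_mem_of_mem_blueAfter {V : Type*} {G : SimpleGraph V} {leg depth : V → ℕ}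
    (hleg : ∀ u v, G.Adj u v → 0 < depth u → 0 < depth v → leg u = leg v)
    (hdepth : ∀ u v, G.Adj u v → depth u ≤ depth v + 1) (S : Set V) (t : ℕ) :
    ∀ v ∈ blueAfter G S t, t < depth v →
      ∃ s ∈ S, leg s = leg v ∧ depth s ≤ depth v + t ∧ depth v ≤ depth s + t := by
  induction t with
  | zero => exact fun v hv _ => ⟨v, hv, rfl, le_rfl, le_rfl⟩
  | succ t ih =>
    intro v hv ht
    rw [blueAfter, Function.iterate_succ_apply'] at hv
    obtain hv | ⟨u, hu, C, hC⟩ := hv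
    · obtain ⟨s, hs, h1, h2, h3⟩ := ih v hv (by omega)
      exact ⟨s, hs, h1, by omega, by omega⟩
    · have huv : G.Adj u v := by
        have : v ∈ G.neighborSet u ∩ (Subtype.val '' C.supp) := hC ▸ rfl
        exact this.1
      have hd1 := hdepth u v huv
      have hd2 := hdepth v u huv.symm
      -- The forcing vertex has depth above `t`, so it is not the centre and lies on the leg of `v`.
      obtain ⟨s, hs, h1, h2, h3⟩ := ih u hu (by omega)
      exact ⟨s, hs, h1.trans (hleg u v huv (by omega) (by omega)), by omega, by omega⟩

/-- A graph containing legs of all the lengths `m + 1, …, 3 * m`, attached at their vertices of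
depth one, has throttling number at least `3 * m`. -/
theorem three_mul_le_throttlingNumber {V : Type*} [Fintype V] {G : SimpleGraph V}
    {leg depth : V → ℕ} {m : ℕ}
    (hleg : ∀ u v, G.Adj u v → 0 < depth u → 0 < depth v → leg u = leg v)
    (hdepth : ∀ u v, G.Adj u v → depth u ≤ depth v + 1)
    (hex : ∀ i d, m < i → i ≤ 3 * m → 0 < d → d ≤ i → ∃ v, leg v = i ∧ depth v = d) :
    3 * m ≤ throttlingNumber G := by
  classical
  have key : ∀ (S : Finset V) (t : ℕ), blueAfter G (S : Set V) t = Set.univ →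
      3 * m ≤ S.card + t := by
    intro S t hS
    have hnear : ∀ v, t < depth v →
        ∃ s ∈ S, leg s = leg v ∧ depth s ≤ depth v + t ∧ depth v ≤ depth s + t := fun v hv =>
      exists_mem_of_mem_blueAfter hleg hdepth (S : Set V) t v (hS ▸ Set.mem_univ v) hv
    -- The leaf of such a leg needs an initial vertex within `t` of it.
    have h1 : Finset.Ioc (max m t) (3 * m) ⊆
        (S.filter fun s => leg s ≤ depth s + t).image leg := by
      intro i hi
      rw [Finset.mem_Ioc, max_lt_iff] at hi
      obtain ⟨v, hv, hvd⟩ := hex i i hi.1.1 hi.2 (by omega) le_rfl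
      obtain ⟨s, hs, h1, h2, h3⟩ := hnear v (by omega)
      exact Finset.mem_image.2 ⟨s, Finset.mem_filter.2 ⟨hs, by omega⟩, by omega⟩
    -- The vertex `2 * t + 1` above the leaf is still deeper than `t`, and no initial vertex is
    -- within `t` of both.
    have h2 : Finset.Ioc (max m (3 * t + 1)) (3 * m) ⊆
        (S.filter fun s => ¬ leg s ≤ depth s + t).image leg := by
      intro i hi
      rw [Finset.mem_Ioc, max_lt_iff] at hi
      obtain ⟨v, hv, hvd⟩ := hex i (i - (2 * t + 1)) hi.1.1 hi.2 (by omega) (by omega)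
      obtain ⟨s, hs, h1, h2, h3⟩ := hnear v (by omega)
      exact Finset.mem_image.2 ⟨s, Finset.mem_filter.2 ⟨hs, by omega⟩, by omega⟩
    have h3 := (Finset.card_le_card h1).trans Finset.card_image_le
    have h4 := (Finset.card_le_card h2).trans Finset.card_image_le
    have h5 := S.card_filter_add_card_filter_not (fun s => leg s ≤ depth s + t)
    rw [Nat.card_Ioc] at h3 h4
    -- For `t ≥ m` the first count suffices; for `t < m` the two are added.
    omega
  have hle : ((3 * m : ℕ) : ℕ∞) ≤ ⨅ k : ℕ, ((k : ℕ∞) + minPropTime G k) := by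
    refine le_iInf fun k => ?_
    rw [← tsub_le_iff_left]
    refine le_iInf₂ fun S hS => le_iInf₂ fun t ht => ?_
    rw [tsub_le_iff_left, ← hS]
    exact_mod_cast key S t ht
  rw [throttlingNumber, ← ENat.natCast_le_natCast, ENat.natCast_toNat (iInf_ne_top G)]
  exact hle

end PSDForcing

/-- The vertices of a spider: a centre, legs of the lengths `m + 1, …, 3 * m`, and `x` legs of
length one. -/
abbrev SpiderVertex (m x : ℕ) : Type :=
  Unit ⊕ (Σ i : Fin (2 * m), Fin (m + 1 + i)) ⊕ Fin x

namespace SpiderVertex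

variable {m x : ℕ}

/-- The length of the leg of a vertex; zero for the centre and the legs of length one. -/
def leg : SpiderVertex m x → ℕ
  | .inr (.inl a) => m + 1 + a.1
  | _ => 0

/-- The distance of a vertex to the centre. -/
def depth : SpiderVertex m x → ℕ
  | .inl _ => 0
  | .inr (.inl a) => a.2 + 1
  | .inr (.inr _) => 1

/-- The neighbour of a vertex in the direction of the centre. -/
def parent : SpiderVertex m x → SpiderVertex m x
  | .inr (.inl ⟨i, j⟩) =>
    if j.1 = 0 then .inl () else .inr (.inl ⟨i, ⟨j - 1, (Nat.sub_le _ _).trans_lt j.2⟩⟩)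
  | _ => .inl ()

theorem depth_parent (v : SpiderVertex m x) (hv : v ≠ .inl ()) :
    depth v = depth (parent v) + 1 := by
  rcases v with u | ⟨i, j⟩ | y
  · exact absurd rfl hv
  · by_cases hj : j.1 = 0
    · simp [depth, parent, hj]
    · simp only [depth, parent, hj, if_false]
      omega
  · rfl

theorem leg_parent (v : SpiderVertex m x) (hv : 0 < depth (parent v)) :
    leg (parent v) = leg v := by
  rcases v with u | ⟨i, j⟩ | y
  · rfl
  · by_cases hj : j.1 = 0
    · simp [depth, parent, hj] at hv
    · simp [leg, parent, hj]
  · rfl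

theorem exists_leg_depth {i d : ℕ} (hi : m < i) (him : i ≤ 3 * m) (hd : 0 < d) (hdi : d ≤ i) :
    ∃ v : SpiderVertex m x, leg v = i ∧ depth v = d := by
  refine ⟨.inr (.inl ⟨⟨i - (m + 1), by omega⟩, ⟨d - 1, ?_⟩⟩), ?_, ?_⟩
  · simp only
    omega
  · simp only [leg]
    omega
  · simp only [depth]
    omega

theorem card : Fintype.card (SpiderVertex m x) = 4 * m ^ 2 + m + 1 + x := by
  have h : ∀ k : ℕ, 2 * ∑ i : Fin k, (m + 1 + (i : ℕ)) = k * (2 * m + 1 + k) := by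
    intro k
    induction k with
    | zero => simp
    | succ k ih =>
      rw [Fin.sum_univ_castSucc, mul_add]
      simp only [Fin.val_castSucc, Fin.val_last]
      rw [ih]
      ring
  have h2 := h (2 * m)
  simp only [Fintype.card_sum, Fintype.card_unit, Fintype.card_sigma, Fintype.card_fin]
  nlinarith

end SpiderVertex

open SpiderVertex in
theorem exists_isTree_three_mul_le_throttlingNumber {m n : ℕ} (h : 4 * m ^ 2 + m + 1 ≤ n) :
    ∃ T : SimpleGraph (Fin n), T.IsTree ∧ 3 * m ≤ PSDForcing.throttlingNumber T := by
  -- Legs of length one pad the order to exactly `n`; the bound ignores them.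
  have e : Fin n ≃ SpiderVertex m (n - (4 * m ^ 2 + m + 1)) :=
    (Fintype.equivFinOfCardEq (by rw [SpiderVertex.card]; omega)).symm
  have hroot : ∀ v, v ≠ e.symm (.inl ()) → e v ≠ .inl () := fun v hv h =>
    hv (by rw [← h, e.symm_apply_apply])
  refine ⟨SimpleGraph.fromRel fun u v => e.symm (parent (e u)) = v,
    isTree_fromRel_parent (e.symm (.inl ())) _ (fun v => depth (e v)) ?_ fun v hv => ?_,
    PSDForcing.three_mul_le_throttlingNumber (leg := fun v => leg (e v))
      (depth := fun v => depth (e v)) ?_ ?_ ?_⟩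
  · simp [parent]
  · have := depth_parent (e v) (hroot v hv)
    simp only [Equiv.apply_symm_apply]
    omega
  · intro u v huv hu hv
    obtain ⟨-, rfl | rfl⟩ := (SimpleGraph.fromRel_adj _ _ _).1 huv
    · simp only [Equiv.apply_symm_apply] at hv ⊢
      exact (leg_parent _ hv).symm
    · simp only [Equiv.apply_symm_apply] at hu ⊢
      exact leg_parent _ hu
  · have aux : ∀ w : SpiderVertex m (n - (4 * m ^ 2 + m + 1)),
        depth w ≤ depth (parent w) + 1 ∧ depth (parent w) ≤ depth w + 1 := by
      intro w
      by_cases hw : w = .inl ()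
      · subst hw
        simp [parent]
      · have := depth_parent w hw
        omega
    intro u v huv
    obtain ⟨-, rfl | rfl⟩ := (SimpleGraph.fromRel_adj _ _ _).1 huv
    · simpa using (aux (e u)).1
    · simpa using (aux (e v)).2
  · intro i d hi him hd hdi
    obtain ⟨v, hv⟩ := exists_leg_depth (x := n - (4 * m ^ 2 + m + 1)) hi him hd hdi
    exact ⟨e.symm v, by simpa using hv⟩

theorem mainTheorem11 :
    ∃ N : ℕ, ∀ n : ℕ, N ≤ n →
      ∃ T : SimpleGraph (Fin n), T.IsTree ∧
        (1.4502 : ℝ) * Real.sqrt (n : ℝ) < (PSDForcing.throttlingNumber T : ℝ) := by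
  -- Maximality of `m` gives `n < 4 * m ^ 2 + 9 * m + 6`; `m ≥ 50` amply ensures that `1.4502 ^ 2`
  -- times this is below `9 * m ^ 2`.
  refine ⟨4 * 50 ^ 2 + 50 + 1, fun n hn => ?_⟩
  set m := Nat.findGreatest (fun m => 4 * m ^ 2 + m + 1 ≤ n) n with hm
  have hmn : 4 * m ^ 2 + m + 1 ≤ n :=
    Nat.findGreatest_spec (P := fun m => 4 * m ^ 2 + m + 1 ≤ n) (m := 50) (by omega) hn
  have hm50 : 50 ≤ m := Nat.le_findGreatest (by omega) hn
  have hlt : n < 4 * (m + 1) ^ 2 + (m + 1) + 1 := by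
    by_contra hcon
    have h1 : m + 1 ≤ m :=
      Nat.le_findGreatest (P := fun m => 4 * m ^ 2 + m + 1 ≤ n) (by nlinarith) (by omega)
    omega
  obtain ⟨T, hT, hth⟩ := exists_isTree_three_mul_le_throttlingNumber hmn
  refine ⟨T, hT, ?_⟩
  have hth' : (3 : ℝ) * m ≤ PSDForcing.throttlingNumber T := by exact_mod_cast hth
  have hlt' : (n : ℝ) < 4 * (m + 1) ^ 2 + (m + 1) + 1 := by exact_mod_cast hlt
  have hm' : (50 : ℝ) ≤ m := by exact_mod_cast hm50
  refine lt_of_lt_of_le ?_ hth'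
  refine lt_of_pow_lt_pow_left₀ 2 (by positivity) ?_
  rw [mul_pow, Real.sq_sqrt (Nat.cast_nonneg n)]
  nlinarith
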